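/- Let $E$ be a Dedekind complete Riesz space (real vector lattice) with a weak order unit $e$ (that is, $e \ge 0$, and $x \wedge e = 0$ with $x \ge 0$ implies $x = 0$). Let $(X_n)_{n\in\mathbb N}$ be a sequence in $E$ and let $X \in E$. A sequence $(Y_n)$ in a Riesz space order converges to $Y$ if there is a decreasing sequence $(V_n)$ in that space with $\inf_n V_n = 0$ and $|Y_n - Y| \le V_n$ for all $n$; it is unbounded order (uo-) convergent to $Y$ if $(|Y_n - Y| \wedge Z)_n$ order converges to $0$ for every $Z \ge 0$ in the space. Let $E^u$ be the universal completion of $E$, that is, a Riesz space which is universally complete (Dedekind complete, and every nonempty set of pairwise disjoint positive elements has a supremum) and which contains $E$, up to Riesz isomorphism, as an order dense Riesz subspace (every $0 < w \in E^u$ dominates some $0 < x \in E$). Then the following are equivalent: 1. $(X_n)$ is uo-convergent to $X$ in $E$. 2. $(|X_n - X| \wedge k e)_n$ is order convergent to $0$ in $E$ for every $k \in \mathbb N$. 3. $(X_n)$ is order convergent to $X$ in $E^u$. -/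

import Mathlib

/-!
Riesz spaces are real ordered vector spaces that are lattices, given by the Mathlib classes
`[AddCommGroup E] [Lattice E] [IsOrderedAddMonoid E] [Module ℝ E] [IsOrderedModule ℝ E]`.
-/

namespace RieszSpace

universe u v

/-- Dedekind completeness: every nonempty set that is bounded above has a supremum. -/
def IsDedekindComplete (E : Type u) [Lattice E] : Prop :=
  ∀ s : Set E, s.Nonempty → BddAbove s → ∃ a : E, IsLUB s a

/-- Lateral completeness: every nonempty set of pairwise disjoint positive elements has a
supremum. -/
def IsLaterallyComplete (E : Type u) [AddCommGroup E] [Lattice E] : Prop :=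
  ∀ s : Set E, s.Nonempty → (∀ x ∈ s, 0 ≤ x) → s.Pairwise (fun x y => x ⊓ y = 0) →
    ∃ a : E, IsLUB s a

/-- Universal completeness: Dedekind complete and laterally complete. -/
def IsUniversallyComplete (E : Type u) [AddCommGroup E] [Lattice E] : Prop :=
  IsDedekindComplete E ∧ IsLaterallyComplete E

/-- A weak order unit: a positive element that is disjoint from no positive element other
than `0`. -/
def IsWeakOrderUnit {E : Type u} [AddCommGroup E] [Lattice E] (e : E) : Prop :=
  0 ≤ e ∧ ∀ x : E, 0 ≤ x → x ⊓ e = 0 → x = 0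

/-- Order convergence of a sequence: `|Y n - y| ≤ V n` for some sequence `V n ↓ 0`. -/
def OrderTendsto {E : Type u} [AddCommGroup E] [Lattice E] (Y : ℕ → E) (y : E) : Prop :=
  ∃ V : ℕ → E, Antitone V ∧ IsGLB (Set.range V) 0 ∧ ∀ n, |Y n - y| ≤ V n

/-- Unbounded order convergence of a sequence: `|Y n - y| ⊓ z` order converges to `0`
for every positive `z`. -/
def UOTendsto {E : Type u} [AddCommGroup E] [Lattice E] (Y : ℕ → E) (y : E) : Prop :=
  ∀ z : E, 0 ≤ z → OrderTendsto (fun n => |Y n - y| ⊓ z) 0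

/-- `U`, with the map `ι : E → U`, is a universal completion of the Riesz space `E`:
`U` is universally complete and `ι` is an isomorphism of Riesz spaces from `E` onto an
order dense Riesz subspace of `U`. -/
structure IsUniversalCompletion {E : Type u} {U : Type v}
    [AddCommGroup E] [Lattice E] [Module ℝ E] [AddCommGroup U] [Lattice U] [Module ℝ U]
    (ι : E →ₗ[ℝ] U) : Prop where
  universallyComplete : IsUniversallyComplete U
  injective : Function.Injective ι
  map_sup : ∀ x y : E, ι (x ⊔ y) = ι x ⊔ ι y
  map_inf : ∀ x y : E, ι (x ⊓ y) = ι x ⊓ ι y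
  order_dense : ∀ w : U, 0 < w → ∃ x : E, 0 < ι x ∧ ι x ≤ w

end RieszSpace

namespace RieszSpace

/-! For a bounded positive sequence, order convergence to `0` means that any lower bound `w ≥ 0` of
all tail suprema vanishes. From 2, distributivity puts `w ⊓ e` below a sequence decreasing to `0`,
and the weak unit kills `w`. From 3, the embedding preserves suprema, so `ι w` is below such a
sequence. From 1 to 3 the difficulty is boundedness in `U`. If `|X n - x| ⊓ u ≤ V n` with `V`
decreasing to `0` and `u > 0`, some `(u - V n)⁺` is nonzero, and on its band all terms from `n` on
are at most `u`. Such bands lie below every positive element; lateral completeness glues the local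
bounds over a maximal disjoint family. -/

/-- If a sequence of positive elements is bounded, then the suprema of its tails witness its order
convergence to `0` as soon as these suprema have no positive lower bound other than `0`. -/
theorem IsDedekindComplete.exists_antitone_isGLB {E : Type*} [AddCommGroup E] [Lattice E]
    (hE : IsDedekindComplete E) {Y : ℕ → E} {b : E}
    (hY : ∀ n, 0 ≤ Y n) (hb : ∀ n, Y n ≤ b)
    (h : ∀ w, 0 ≤ w → ∀ W : ℕ → E, (∀ n, IsLUB (Y '' Set.Ici n) (W n)) → (∀ n, w ≤ W n) →
      w = 0) :
    ∃ W : ℕ → E, Antitone W ∧ IsGLB (Set.range W) 0 ∧ ∀ n, Y n ≤ W n := by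
  have hex : ∀ n, ∃ a, IsLUB (Y '' Set.Ici n) a := fun n =>
    hE _ ⟨_, Set.mem_image_of_mem _ Set.self_mem_Ici⟩
      ⟨b, by rintro _ ⟨m, -, rfl⟩; exact hb m⟩
  choose W hW using hex
  have hYW : ∀ n, Y n ≤ W n := fun n => (hW n).1 (Set.mem_image_of_mem _ Set.self_mem_Ici)
  have hW0 : ∀ n, 0 ≤ W n := fun n => (hY n).trans (hYW n)
  refine ⟨W, ?_, ⟨?_, ?_⟩, hYW⟩
  · intro m n hmn
    exact (hW n).mono (hW m) (Set.image_mono (Set.Ici_subset_Ici.2 hmn))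
  · rintro _ ⟨n, rfl⟩
    exact hW0 n
  · intro w hw
    have : w ⊔ 0 = 0 :=
      h _ le_sup_right W hW fun n => sup_le (hw ⟨n, rfl⟩) (hW0 n)
    exact sup_eq_right.1 this

section Lattice

variable {E : Type*} [AddCommGroup E] [Lattice E] [IsOrderedAddMonoid E]

/-- One inequality of the infinite distributive law. -/
theorem inf_le_of_isLUB {s : Set E} {a z r : E} (ha : IsLUB s a)
    (h : ∀ t ∈ s, t ⊓ z ≤ r) : a ⊓ z ≤ r := by
  have key : a ≤ r - z + a ⊔ z := by
    refine ha.2 fun t ht => ?_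
    have h1 : t = t ⊓ z - z + t ⊔ z := by
      rw [sub_add_eq_add_sub, inf_add_sup, add_sub_cancel_right]
    calc t = t ⊓ z - z + t ⊔ z := h1
      _ ≤ r - z + a ⊔ z :=
        add_le_add (sub_le_sub_right (h t ht) z) (sup_le_sup_right (ha.1 ht) z)
  have h2 : a ⊓ z = a + z - a ⊔ z := by rw [← inf_add_sup, add_sub_cancel_right]
  rw [h2, sub_le_iff_le_add]
  calc a + z ≤ r - z + a ⊔ z + z := add_le_add_left key z
    _ = r + a ⊔ z := by abel

theorem inf_nsmul_eq_zero {x a : E} (hx : 0 ≤ x) (ha : 0 ≤ a) (h : x ⊓ a = 0) (k : ℕ) :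
    x ⊓ k • a = 0 := by
  induction k with
  | zero => simpa using hx
  | succ k ih =>
    have hk : 0 ≤ k • a := nsmul_nonneg ha k
    refine le_antisymm ?_ (le_inf hx (nsmul_nonneg ha _))
    rw [← ih]
    refine le_inf inf_le_left ?_
    calc x ⊓ (k + 1) • a ≤ (k • a + x) ⊓ (k • a + a) :=
          inf_le_inf (le_add_of_nonneg_left hk) (succ_nsmul a k).le
      _ = k • a + x ⊓ a := (add_inf _ _ _).symm
      _ = k • a := by rw [h, add_zero]

theorem sub_inf_inf_sub_inf (a b : E) : (a - a ⊓ b) ⊓ (b - a ⊓ b) = 0 := by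
  rw [← inf_sub, sub_self]

/-- If `a` lives where `y ≤ u`, then so does every `y ⊓ k • a`. -/
theorem inf_nsmul_le {y u a : E} (hu : 0 ≤ u) (ha : 0 ≤ a) (h : a ≤ u - y ⊓ u) (k : ℕ) :
    y ⊓ k • a ≤ u := by
  have h0 : 0 ≤ y - y ⊓ u := sub_nonneg.2 inf_le_left
  have h1 : (y - y ⊓ u) ⊓ a = 0 :=
    le_antisymm ((inf_le_inf_left _ h).trans (sub_inf_inf_sub_inf y u).le) (le_inf h0 ha)
  have h2 := inf_nsmul_eq_zero h0 ha h1 k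
  calc y ⊓ k • a ≤ (y ⊓ u + (y - y ⊓ u)) ⊓ (u + k • a) := by
        rw [add_sub_cancel]
        exact inf_le_inf_left _ (le_add_of_nonneg_left hu)
    _ ≤ (u + (y - y ⊓ u)) ⊓ (u + k • a) :=
        inf_le_inf_right _ (add_le_add_left inf_le_right _)
    _ = u + (y - y ⊓ u) ⊓ k • a := (add_inf _ _ _).symm
    _ = u := by rw [h2, add_zero]

/-- The Archimedean property: the supremum `s` of the multiples also bounds the shifted multiples,
so `s ≤ s - b`. -/
theorem IsDedekindComplete.nonpos_of_nsmul_le (hE : IsDedekindComplete E) {b y : E}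
    (h : ∀ k : ℕ, k • b ≤ y) : b ≤ 0 := by
  obtain ⟨s, hs⟩ := hE (Set.range fun k : ℕ => k • b) (Set.range_nonempty _)
    ⟨y, by rintro _ ⟨k, rfl⟩; exact h k⟩
  have h1 : s ≤ s - b := by
    refine hs.2 ?_
    rintro _ ⟨k, rfl⟩
    rw [le_sub_iff_add_le, ← succ_nsmul]
    exact hs.1 ⟨k + 1, rfl⟩
  simpa using h1

theorem orderTendsto_zero_iff {Y : ℕ → E} (hY : ∀ n, 0 ≤ Y n) :
    OrderTendsto Y 0 ↔
      ∃ V : ℕ → E, Antitone V ∧ IsGLB (Set.range V) 0 ∧ ∀ n, Y n ≤ V n := by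
  simp only [OrderTendsto, sub_zero, abs_of_nonneg (hY _)]

theorem uoTendsto_of_inf_weakOrderUnit (hE : IsDedekindComplete E) {e : E}
    (he : IsWeakOrderUnit e) {X : ℕ → E} {x : E}
    (h : OrderTendsto (fun n => |X n - x| ⊓ e) 0) : UOTendsto X x := by
  intro z hz
  have hY : ∀ n, 0 ≤ |X n - x| ⊓ z := fun n => le_inf (abs_nonneg _) hz
  rw [orderTendsto_zero_iff hY]
  rw [orderTendsto_zero_iff fun n => le_inf (abs_nonneg _) he.1] at h
  obtain ⟨V, hV, hV0, hXV⟩ := h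
  refine hE.exists_antitone_isGLB hY (fun n => inf_le_right) fun w hw W hW hwW => ?_
  refine he.2 w hw (le_antisymm (hV0.2 ?_) (le_inf hw he.1))
  rintro _ ⟨n, rfl⟩
  refine (inf_le_inf_right e (hwW n)).trans (inf_le_of_isLUB (hW n) ?_)
  rintro _ ⟨m, hm, rfl⟩
  exact (inf_le_inf_right e inf_le_left).trans ((hXV m).trans (hV hm))

/-- In a universally complete space, a sequence of positive elements is bounded above if it is
bounded on the principal bands of a set of elements that minorizes every positive element. -/
theorem IsUniversallyComplete.bddAbove_range (hE : IsUniversallyComplete E) {Y : ℕ → E}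
    (hY : ∀ n, 0 ≤ Y n)
    (h : ∀ w : E, 0 < w → ∃ a, 0 < a ∧ a ≤ w ∧
      BddAbove (Set.range fun p : ℕ × ℕ => Y p.1 ⊓ p.2 • a)) :
    BddAbove (Set.range Y) := by
  let B : E → Set E := fun a => Set.range fun p : ℕ × ℕ => Y p.1 ⊓ p.2 • a
  let F : Set (Set E) :=
    {D | (∀ a ∈ D, 0 ≤ a ∧ BddAbove (B a)) ∧ D.Pairwise fun x y => x ⊓ y = 0}
  obtain ⟨D, hD⟩ : ∃ D, Maximal (· ∈ F) D := by
    refine zorn_subset F fun c hc hchain => ⟨⋃₀ c, ⟨?_, ?_⟩, fun s hs => Set.subset_sUnion_of_mem hs⟩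
    · rintro a ⟨s, hs, ha⟩
      exact (hc hs).1 a ha
    · exact (Set.pairwise_sUnion hchain.directedOn).2 fun s hs => (hc hs).2
  have hmem : ∀ a, 0 ≤ a → BddAbove (B a) → (∀ b ∈ D, b ⊓ a = 0) → a ∈ D := by
    intro a ha hBa hdisj
    refine hD.2 (y := insert a D) ⟨?_, ?_⟩ (Set.subset_insert a D) (Set.mem_insert a D)
    · rintro b (rfl | hb)
      · exact ⟨ha, hBa⟩
      · exact hD.1.1 b hb
    · refine hD.1.2.insert fun b hb _ => ⟨?_, hdisj b hb⟩
      rw [inf_comm]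
      exact hdisj b hb
  -- Makes `g '' D` nonempty, as lateral completeness requires.
  have h0D : (0 : E) ∈ D := by
    refine hmem 0 le_rfl ⟨0, ?_⟩ fun b hb => inf_eq_right.2 (hD.1.1 b hb).1
    rintro _ ⟨p, rfl⟩
    simp
  have hg : ∀ a, ∃ g, a ∈ D → IsLUB (B a) g := fun a => by
    by_cases ha : a ∈ D
    · obtain ⟨g, hg⟩ := hE.1 (B a) (Set.range_nonempty _) (hD.1.1 a ha).2
      exact ⟨g, fun _ => hg⟩
    · exact ⟨0, fun h => absurd h ha⟩
  choose g hg using hg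
  have hg0 : ∀ a ∈ D, 0 ≤ g a := fun a ha =>
    (le_inf (hY 0) (nsmul_nonneg (hD.1.1 a ha).1 0)).trans ((hg a ha).1 ⟨(0, 0), rfl⟩)
  obtain ⟨G, hG⟩ : ∃ G, IsLUB (g '' D) G := by
    refine hE.2 _ ⟨_, Set.mem_image_of_mem g h0D⟩ ?_ ?_
    · rintro _ ⟨a, ha, rfl⟩
      exact hg0 a ha
    · rintro _ ⟨a, ha, rfl⟩ _ ⟨b, hb, rfl⟩ hab
      have hab' : a ≠ b := fun h => hab (by rw [h])
      refine le_antisymm (inf_le_of_isLUB (hg a ha) ?_) (le_inf (hg0 a ha) (hg0 b hb))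
      rintro _ ⟨p, rfl⟩
      rw [inf_comm]
      refine inf_le_of_isLUB (hg b hb) ?_
      rintro _ ⟨q, rfl⟩
      have ha0 := (hD.1.1 a ha).1
      have hb0 := (hD.1.1 b hb).1
      have h1 : a ⊓ q.2 • b = 0 := inf_nsmul_eq_zero ha0 hb0 (hD.1.2 ha hb hab') _
      rw [inf_comm] at h1
      exact (inf_le_inf inf_le_right inf_le_right).trans
        (inf_nsmul_eq_zero (nsmul_nonneg hb0 _) ha0 h1 p.2).le
  refine ⟨G, ?_⟩
  rintro _ ⟨n, rfl⟩
  by_contra hn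
  -- The excess of `Y n` over `G` is disjoint from `D`, so an admissible element below it
  -- contradicts maximality.
  have hw : 0 < Y n - Y n ⊓ G :=
    lt_of_le_of_ne (sub_nonneg.2 inf_le_left) fun h =>
      hn (inf_eq_left.1 (sub_eq_zero.1 h.symm).symm)
  have hdisj : ∀ a ∈ D, a ⊓ (Y n - Y n ⊓ G) = 0 := by
    intro a ha
    have ha0 := (hD.1.1 a ha).1
    refine le_antisymm (hE.1.nonpos_of_nsmul_le (y := Y n) fun k => ?_) (le_inf ha0 hw.le)
    -- Since `Y n ⊓ k • a ≤ G`, one more copy of the excess still fits below `Y n`.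
    suffices k • (a ⊓ (Y n - Y n ⊓ G)) ≤ Y n ⊓ k • a from this.trans inf_le_left
    induction k with
    | zero => simpa using hY n
    | succ k ih =>
      have hkG : Y n ⊓ k • a ≤ Y n ⊓ G :=
        le_inf inf_le_left (((hg a ha).1 ⟨(n, k), rfl⟩).trans (hG.1 ⟨a, ha, rfl⟩))
      rw [succ_nsmul, succ_nsmul]
      refine le_inf ?_ (add_le_add (ih.trans inf_le_right) inf_le_left)
      calc _ ≤ Y n ⊓ G + (Y n - Y n ⊓ G) := add_le_add (ih.trans hkG) inf_le_right
        _ = Y n := add_sub_cancel _ _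
  obtain ⟨a, ha, haw, hBa⟩ := h _ hw
  have haD : a ∈ D := hmem a ha.le hBa fun b hb =>
    le_antisymm ((inf_le_inf_left b haw).trans (hdisj b hb).le) (le_inf (hD.1.1 b hb).1 ha.le)
  have := hdisj a haD
  rw [inf_eq_left.2 haw] at this
  exact ha.ne' this

end Lattice

theorem IsUniversalCompletion.map_le_map_iff {E U : Type*} [AddCommGroup E] [Lattice E]
    [Module ℝ E] [AddCommGroup U] [Lattice U] [Module ℝ U] {ι : E →ₗ[ℝ] U}
    (hι : IsUniversalCompletion ι) {a b : E} : ι a ≤ ι b ↔ a ≤ b := by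
  rw [← inf_eq_left, ← hι.map_inf, hι.injective.eq_iff, inf_eq_left]

theorem IsUniversalCompletion.abs_map_sub {E U : Type*} [AddCommGroup E] [Lattice E]
    [Module ℝ E] [AddCommGroup U] [Lattice U] [Module ℝ U] {ι : E →ₗ[ℝ] U}
    (hι : IsUniversalCompletion ι) (a b : E) : |ι a - ι b| = ι |a - b| := by
  rw [abs, abs, hι.map_sup, map_neg, map_sub]

section Completion

variable {E U : Type*} [AddCommGroup E] [Lattice E] [IsOrderedAddMonoid E] [Module ℝ E]
  [AddCommGroup U] [Lattice U] [IsOrderedAddMonoid U] [Module ℝ U] {ι : E →ₗ[ℝ] U}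

/-- The embedding into the universal completion preserves suprema. -/
theorem IsUniversalCompletion.map_le_of_isLUB (hι : IsUniversalCompletion ι) {s : Set E} {a : E}
    (ha : IsLUB s a) {v : U} (h : ∀ t ∈ s, ι t ≤ v) : ι a ≤ v := by
  by_contra hn
  have hw : 0 < ι a - ι a ⊓ v :=
    lt_of_le_of_ne (sub_nonneg.2 inf_le_left) fun h =>
      hn (inf_eq_left.1 (sub_eq_zero.1 h.symm).symm)
  obtain ⟨c, hc, hcw⟩ := hι.order_dense _ hw
  -- Each `ι t` is at most `ι a ⊓ v ≤ ι a - ι c`.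
  have h1 : a ≤ a - c := by
    refine ha.2 fun t ht => hι.map_le_map_iff.1 ?_
    rw [map_sub]
    exact (le_inf (hι.map_le_map_iff.2 (ha.1 ht)) (h t ht)).trans (le_sub_comm.1 hcw)
  have h2 : c ≤ 0 := by simpa using h1
  have h3 := hι.map_le_map_iff.2 h2
  rw [map_zero] at h3
  exact hc.not_ge h3

theorem IsUniversalCompletion.uoTendsto_of_orderTendsto (hι : IsUniversalCompletion ι)
    (hE : IsDedekindComplete E) {X : ℕ → E} {x : E}
    (h : OrderTendsto (fun n => ι (X n)) (ι x)) : UOTendsto X x := by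
  intro z hz
  have hY : ∀ n, 0 ≤ |X n - x| ⊓ z := fun n => le_inf (abs_nonneg _) hz
  rw [orderTendsto_zero_iff hY]
  obtain ⟨V, hV, hV0, hXV⟩ := h
  refine hE.exists_antitone_isGLB hY (fun n => inf_le_right) fun w hw W hW hwW => ?_
  refine le_antisymm (hι.map_le_map_iff.1 ?_) hw
  rw [map_zero]
  refine hV0.2 ?_
  rintro _ ⟨n, rfl⟩
  refine (hι.map_le_map_iff.2 (hwW n)).trans (hι.map_le_of_isLUB (hW n) ?_)
  rintro _ ⟨m, hm, rfl⟩
  refine (hι.map_le_map_iff.2 inf_le_left).trans (le_trans ?_ (hV hm))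
  rw [← hι.abs_map_sub]
  exact hXV m

theorem IsUniversalCompletion.orderTendsto_of_uoTendsto (hι : IsUniversalCompletion ι)
    {X : ℕ → E} {x : E} (h : UOTendsto X x) : OrderTendsto (fun n => ι (X n)) (ι x) := by
  have hY : ∀ n, 0 ≤ |ι (X n) - ι x| := fun n => abs_nonneg _
  have hdense : ∀ w : U, 0 < w → ∃ u : E, 0 < ι u ∧ ι u ≤ w ∧ ∃ V : ℕ → E, Antitone V ∧
      (∀ n, |ι (X n) - ι x| ⊓ ι u ≤ ι (V n)) ∧ ∃ n, ¬ ι u ≤ ι (V n) := by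
    intro w hw
    obtain ⟨u, hu, huw⟩ := hι.order_dense w hw
    have hu0 : 0 ≤ u := by
      rw [← hι.map_le_map_iff, map_zero]
      exact hu.le
    have hV := h u hu0
    rw [orderTendsto_zero_iff fun n => le_inf (abs_nonneg _) hu0] at hV
    obtain ⟨V, hV, hV0, hXV⟩ := hV
    refine ⟨u, hu, huw, V, hV, fun n => ?_, ?_⟩
    · rw [hι.abs_map_sub, ← hι.map_inf]
      exact hι.map_le_map_iff.2 (hXV n)
    · by_contra! hle
      have : u ≤ 0 := hV0.2 (by rintro _ ⟨n, rfl⟩; exact hι.map_le_map_iff.1 (hle n))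
      rw [← hι.map_le_map_iff, map_zero] at this
      exact hu.not_ge this
  obtain ⟨b, hb⟩ := hι.universallyComplete.bddAbove_range hY fun w hw => by
    obtain ⟨u, hu, huw, V, hV, hXV, n, hn⟩ := hdense w hw
    -- On the band of this element `ι u` bounds the terms from `n` on; the sum covers the earlier
    -- ones.
    have ha : 0 < ι u - ι u ⊓ ι (V n) :=
      lt_of_le_of_ne (sub_nonneg.2 inf_le_left) fun h =>
        hn (inf_eq_left.1 (sub_eq_zero.1 h.symm).symm)
    have hV0 : 0 ≤ ι (V n) := (le_inf (hY n) hu.le).trans (hXV n)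
    refine ⟨_, ha, (sub_le_self _ (le_inf hu.le hV0)).trans huw,
      ι u + ∑ m ∈ Finset.range n, |ι (X m) - ι x|, ?_⟩
    rintro _ ⟨⟨m, k⟩, rfl⟩
    rcases lt_or_ge m n with hmn | hmn
    · exact inf_le_left.trans ((Finset.single_le_sum (fun i _ => hY i)
        (Finset.mem_range.2 hmn)).trans (le_add_of_nonneg_left hu.le))
    · refine (inf_nsmul_le hu.le ha.le (sub_le_sub_left (le_inf inf_le_right ?_) _) k).trans
        (le_add_of_nonneg_right (Finset.sum_nonneg fun i _ => hY i))
      exact (hXV m).trans (hι.map_le_map_iff.2 (hV hmn))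
  refine hι.universallyComplete.1.exists_antitone_isGLB hY (fun n => hb ⟨n, rfl⟩)
    fun w hw W hW hwW => ?_
  by_contra hne
  obtain ⟨u, hu, huw, V, hV, hXV, n, hn⟩ := hdense w (lt_of_le_of_ne hw (Ne.symm hne))
  refine hn ?_
  -- As `ι u ≤ W n`, it equals `W n ⊓ ι u`, which the tail bounds keep below `ι (V n)`.
  rw [← inf_eq_right.2 (huw.trans (hwW n))]
  refine inf_le_of_isLUB (hW n) ?_
  rintro _ ⟨m, hm, rfl⟩
  exact (hXV m).trans (hι.map_le_map_iff.2 (hV hm))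

end Completion

end RieszSpace

theorem mainTheorem8 {E : Type*} [AddCommGroup E] [Lattice E] [IsOrderedAddMonoid E]
    [Module ℝ E] [IsOrderedModule ℝ E]
    (hE : RieszSpace.IsDedekindComplete E)
    (e : E) (he : RieszSpace.IsWeakOrderUnit e)
    (X : ℕ → E) (x : E) :
    (RieszSpace.UOTendsto X x ↔
      ∀ k : ℕ, RieszSpace.OrderTendsto (fun n => |X n - x| ⊓ k • e) 0) ∧
    ∀ (U : Type*) [AddCommGroup U] [Lattice U] [IsOrderedAddMonoid U]
      [Module ℝ U] [IsOrderedModule ℝ U] (ι : E →ₗ[ℝ] U),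
      RieszSpace.IsUniversalCompletion ι →
      List.TFAE [
        RieszSpace.UOTendsto X x,
        ∀ k : ℕ, RieszSpace.OrderTendsto (fun n => |X n - x| ⊓ k • e) 0,
        RieszSpace.OrderTendsto (fun n => ι (X n)) (ι x)] := by
  have h21 : (∀ k : ℕ, RieszSpace.OrderTendsto (fun n => |X n - x| ⊓ k • e) 0) →
      RieszSpace.UOTendsto X x := fun h =>
    -- The case `k = 1` suffices.
    RieszSpace.uoTendsto_of_inf_weakOrderUnit hE he (by simpa using h 1)
  have h12 : RieszSpace.UOTendsto X x ↔
      ∀ k : ℕ, RieszSpace.OrderTendsto (fun n => |X n - x| ⊓ k • e) 0 :=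
    ⟨fun h k => h _ (nsmul_nonneg he.1 k), h21⟩
  refine ⟨h12, fun U _ _ _ _ _ ι hι => ?_⟩
  tfae_have 1 ↔ 2 := h12
  tfae_have 1 → 3 := hι.orderTendsto_of_uoTendsto
  tfae_have 3 → 1 := hι.uoTendsto_of_orderTendsto hE
  tfae_finish
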